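/- **Setting.** Let $D\subset\widetilde D\subset\mathbb R^3$ be bounded open polyhedral sets and let $\mathbb T_h$ be a conforming tetrahedrization of $\widetilde D$ (a finite simplicial complex, all of whose faces are faces of tetrahedra, whose underlying set has interior $\widetilde D$) of maximal mesh-size $h$ (the largest diameter of a tetrahedron), such that its restriction $\mathbb T_h|_D$ (the faces contained in $\overline D$) is a tetrahedrization of $D$. Assume that $\mathbb T_h$ is regular with constant $\kappa>0$: each tetrahedron of $\mathbb T_h$ contains a ball of radius $\kappa h$. Let $x_1,\dots,x_N$ be the vertices of $\mathbb T_h|_D$, let $\mathbb V_h$ be the space of continuous functions $\overline D\to\mathbb R^3$ that are affine on each tetrahedron of $\mathbb T_h|_D$, and let $\phi_n$ be the scalar continuous piecewise affine functions with $\phi_n(x_m)=\delta_{nm}$. Assume $\int_D\nabla\phi_i\cdot\nabla\phi_j\,dx\le 0$ for all $i\ne j$. Let $\mathbb Y_h$ be the lowest order edge element space of Nédélec's first family on $\mathbb T_h$: the fields of the form $a_K+b_K\times x$ ($a_K,b_K\in\mathbb R^3$) on each tetrahedron $K$ whose integrals $\int_e \psi\cdot\tau\,ds$ over the edges $e$ (with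 unit tangent $\tau$) are single-valued, i.e. agree for all tetrahedra that contain $e$. Write $\langle\cdot,\cdot\rangle_\Omega$ and $\|\cdot\|_\Omega$ for the inner product and norm of $L^2(\Omega)$. Let $\lambda_1\neq0$, $\lambda_2>0$, $\sigma\ge0$, $\mu_0>0$, $\mu=\lambda_1^2+\lambda_2^2$, $\theta\in[0,1]$, $T>0$, let $J$ be a positive integer and $k=T/J$. Let $m_0:\overline D\to\mathbb R^3$ be continuous with $|m_0|=1$ a.e. in $D$, and let $H_0$ be a field on the closure of $\widetilde D$ whose tangential component is integrable along each edge of $\mathbb T_h$. **Scheme.** Let $m_h^{(0)}\in\mathbb V_h$ be the nodal interpolant of $m_0$, and let $H_h^{(0)}\in\mathbb Y_h$ be the edge interpolant of $H_0$ (the element with the same edge integrals as $H_0$). For $j=0,\dots,J-1$ let $\mathbb W_h^{(j)}=\{w\in\mathbb V_h: w(x_n)\cdot m_h^{(j)}(x_n)=0,\ n=1,\dots,N\}$, and let $(v_h^{(j+1)},H_h^{(j+1)})\in\mathbb W_h^{(j)}\times\mathbb Y_h$ satisfy, with $H_h^{(j+1/2)}=\tfrac12(H_h^{(j+1)}+H_h^{(j)})$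 and $d_tH_h^{(j+1)}=k^{-1}(H_h^{(j+1)}-H_h^{(j)})$, $$\lambda_2\langle v_h^{(j+1)},w\rangle_D-\lambda_1\langle m_h^{(j)}\times v_h^{(j+1)},w\rangle_D=-\mu\langle\nabla(m_h^{(j)}+k\theta v_h^{(j+1)}),\nabla w\rangle_D+\mu\langle H_h^{(j+1/2)},w\rangle_D\quad\forall w\in\mathbb W_h^{(j)},$$ $$\mu_0\langle d_tH_h^{(j+1)},\zeta\rangle_{\widetilde D}+\sigma\langle\nabla\times H_h^{(j+1/2)},\nabla\times\zeta\rangle_{\widetilde D}=-\mu_0\langle v_h^{(j+1)},\zeta\rangle_{\widetilde D}\quad\forall\zeta\in\mathbb Y_h,$$ where $v_h^{(j+1)}$ is extended by zero outside $D$; then set $$m_h^{(j+1)}=\sum_{n=1}^N\frac{m_h^{(j)}(x_n)+kv_h^{(j+1)}(x_n)}{|m_h^{(j)}(x_n)+kv_h^{(j+1)}(x_n)|}\,\phi_n .$$ **Lemma.** There is a constant $C_1>0$, depending only on $\kappa$ (in particular independent of $j$, $k$ and $h$), such that for all such data and all $j=0,1,\dots,J$ $$\mathcal E_h^{(j)}+C\sum_{i=0}^{j-1}k\|v_h^{(i+1)}\|_D^2+\lambda_2\mu^{-1}\sum_{i=0}^{j-1}k\|d_tH_h^{(i+1)}\|_{\widetilde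 D}^2+2\mu_0^{-1}\sigma\sum_{i=0}^{j-1}k\|\nabla\times H_h^{(i+1/2)}\|_{\widetilde D}^2\le\mathcal E_h^{(0)},$$ where $$\mathcal E_h^{(j)}=\|\nabla m_h^{(j)}\|_D^2+\|H_h^{(j)}\|_{\widetilde D}^2+\lambda_2\mu^{-1}\mu_0^{-1}\sigma\|\nabla\times H_h^{(j)}\|_{\widetilde D}^2$$ and $$C=\begin{cases}\lambda_2\mu^{-1},&\theta\in[\tfrac12,1],\\ \lambda_2\mu^{-1}-(1-2\theta)C_1kh^{-2},&\theta\in[0,\tfrac12).\end{cases}$$ -/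

import Mathlib

namespace MLLG

open MeasureTheory

/-- Three-dimensional Euclidean space. -/
abbrev R3 := EuclideanSpace ℝ (Fin 3)

/-- The cross product `u × v`. -/
noncomputable def cross (u v : R3) : R3 :=
  WithLp.toLp 2 (crossProduct (WithLp.ofLp u) (WithLp.ofLp v))

/-! ### Differential operators and `L²` products

For the finite element functions below (affine, resp. of the form `a + b × x`, on each cell) the
weak gradient and the weak curl are the classical ones, computed inside the cells; the union of the
boundaries of the cells is a null set. -/

/-- The partial derivative `∂u/∂x_i`. -/
noncomputable def pderiv {F : Type*} [NormedAddCommGroup F] [NormedSpace ℝ F]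
    (i : Fin 3) (u : R3 → F) (x : R3) : F :=
  fderiv ℝ u x (EuclideanSpace.single i 1)

/-- The curl `∇ × u`. -/
noncomputable def curl (u : R3 → R3) (x : R3) : R3 :=
  !₂[pderiv 1 u x 2 - pderiv 2 u x 1,
     pderiv 2 u x 0 - pderiv 0 u x 2,
     pderiv 0 u x 1 - pderiv 1 u x 0]

/-- `⟨u, v⟩_Ω`, the inner product of `L²(Ω)`. -/
noncomputable def ip {F : Type*} [NormedAddCommGroup F] [InnerProductSpace ℝ F]
    (Ω : Set R3) (u v : R3 → F) : ℝ :=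
  ∫ x in Ω, inner ℝ (u x) (v x)

/-- `‖u‖²_Ω`, the squared norm of `L²(Ω)`. -/
noncomputable def normSq {F : Type*} [NormedAddCommGroup F] [InnerProductSpace ℝ F]
    (Ω : Set R3) (u : R3 → F) : ℝ :=
  ip Ω u u

/-- `⟨∇u, ∇v⟩_Ω = ∑ i, ⟨∂_i u, ∂_i v⟩_Ω`. -/
noncomputable def gradIp {F : Type*} [NormedAddCommGroup F] [InnerProductSpace ℝ F]
    (Ω : Set R3) (u v : R3 → F) : ℝ :=
  ∑ i : Fin 3, ip Ω (pderiv i u) (pderiv i v)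

/-- `‖∇u‖²_Ω`. -/
noncomputable def gradNormSq {F : Type*} [NormedAddCommGroup F] [InnerProductSpace ℝ F]
    (Ω : Set R3) (u : R3 → F) : ℝ :=
  gradIp Ω u u

/-! ### Tetrahedral meshes -/

/-- The tetrahedra of a simplicial complex, each given by its set of four vertices. -/
def cells (T : Geometry.SimplicialComplex ℝ R3) : Set (Finset R3) :=
  {s | s ∈ T.faces ∧ s.card = 4}

/-- `T` is a (conforming) tetrahedrization of the polyhedral open set `Ω`: a finite simplicial
complex all of whose vertices, edges and triangles are faces of tetrahedra of the complex, and whose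
underlying set has interior `Ω`. -/
structure IsTetrahedrization (T : Geometry.SimplicialComplex ℝ R3) (Ω : Set R3) : Prop where
  finite : T.faces.Finite
  pure : ∀ s ∈ T.faces, ∃ K ∈ cells T, s ⊆ K
  interior_space : interior T.space = Ω

/-- The restriction of a mesh to `D`: all faces contained in `closure D`. -/
def restrict (T : Geometry.SimplicialComplex ℝ R3) (D : Set R3) :
    Geometry.SimplicialComplex ℝ R3 where
  faces := {s | s ∈ T.faces ∧ convexHull ℝ (s : Set R3) ⊆ closure D}
  isRelLowerSet_faces := by
    rintro s ⟨hs, hsD⟩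
    refine ⟨(T.isRelLowerSet_faces hs).1, fun t hts ht => ⟨T.down_closed hs hts ht, ?_⟩⟩
    exact (convexHull_mono (by exact_mod_cast hts)).trans hsD
  indep := fun hs => T.indep hs.1
  inter_subset_convexHull := fun hs ht => T.inter_subset_convexHull hs.1 ht.1

/-- `h` is the maximal mesh-size, i.e. the largest diameter of a tetrahedron. -/
def IsMeshSize (T : Geometry.SimplicialComplex ℝ R3) (h : ℝ) : Prop :=
  IsGreatest {d | ∃ K ∈ cells T, d = Metric.diam (convexHull ℝ (K : Set R3))} h

/-- Regularity of a mesh of maximal mesh-size `h`, with regularity constant `κ`: each tetrahedron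
contains a ball of radius `κ h`. -/
def IsRegularMesh (κ h : ℝ) (T : Geometry.SimplicialComplex ℝ R3) : Prop :=
  ∀ K ∈ cells T, ∃ c : R3, Metric.ball c (κ * h) ⊆ convexHull ℝ (K : Set R3)

/-! ### Continuous piecewise linear elements -/

/-- `u` is continuous and piecewise linear on the mesh `T`. For vector-valued functions on the
restricted mesh this is the space `𝕍_h`. Values off `T.space` are irrelevant. -/
structure IsP1 {F : Type*} [NormedAddCommGroup F] [NormedSpace ℝ F]
    (T : Geometry.SimplicialComplex ℝ R3) (u : R3 → F) : Prop where
  continuousOn : ContinuousOn u T.space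
  affine : ∀ K ∈ cells T, ∃ A : R3 →ᵃ[ℝ] F, Set.EqOn u A (convexHull ℝ (K : Set R3))

/-- `u` is the element of `𝕍_h` with nodal values `g`, i.e. `u = ∑ n, g(x_n) φ_n`. -/
structure IsNodalInterpolant (T : Geometry.SimplicialComplex ℝ R3) (g u : R3 → R3) : Prop where
  isP1 : IsP1 T u
  nodal : ∀ p ∈ T.vertices, u p = g p

/-- `φ` is the nodal basis ("hat") function of the vertex `p`. -/
structure IsHat (T : Geometry.SimplicialComplex ℝ R3) (p : R3) (φ : R3 → ℝ) : Prop where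
  isP1 : IsP1 T φ
  self : φ p = 1
  other : ∀ q ∈ T.vertices, q ≠ p → φ q = 0

/-- `∫_D ∇φ_i · ∇φ_j ≤ 0` for the basis functions of any two different vertices of the mesh. -/
def HasNonposStiffness (T : Geometry.SimplicialComplex ℝ R3) (D : Set R3) : Prop :=
  ∀ p ∈ T.vertices, ∀ q ∈ T.vertices, p ≠ q →
    ∀ φ ψ : R3 → ℝ, IsHat T p φ → IsHat T q ψ → gradIp D φ ψ ≤ 0

/-- The space `𝕎_h` of those `w ∈ 𝕍_h` that are orthogonal to `m` at each vertex. -/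
structure IsTangent (T : Geometry.SimplicialComplex ℝ R3) (m w : R3 → R3) : Prop where
  isP1 : IsP1 T w
  orth : ∀ p ∈ T.vertices, inner ℝ (w p) (m p) = 0

/-! ### Lowest order edge elements of Nédélec's first family -/

/-- The integral `∫_e u · τ ds` over the segment `e` from `p` to `q`, with unit tangent `τ`
pointing from `p` to `q`. -/
noncomputable def edgeIntegral (u : R3 → R3) (p q : R3) : ℝ :=
  ∫ t in (0 : ℝ)..1, inner ℝ (u (p + t • (q - p))) (q - p)

/-- `ψ` has the form `a_K + b_K × x` inside each tetrahedron `K`, and the integral of its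
tangential component over each edge from `p` to `q` is `c p q`, whichever of the tetrahedra at that
edge is used to compute it. -/
def HasEdgeIntegrals (T : Geometry.SimplicialComplex ℝ R3) (c : R3 → R3 → ℝ)
    (ψ : R3 → R3) : Prop :=
  ∀ K ∈ cells T, ∃ a b : R3,
    (∀ x ∈ interior (convexHull ℝ (K : Set R3)), ψ x = a + cross b x) ∧
    ∀ p ∈ K, ∀ q ∈ K, edgeIntegral (fun x => a + cross b x) p q = c p q

/-- The edge element space `𝕐_h`. -/
def IsEdgeElement (T : Geometry.SimplicialComplex ℝ R3) (ψ : R3 → R3) : Prop :=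
  ∃ c : R3 → R3 → ℝ, HasEdgeIntegrals T c ψ

/-- `ψ ∈ 𝕐_h` is the edge interpolant of `u`. -/
def IsEdgeInterpolant (T : Geometry.SimplicialComplex ℝ R3) (u ψ : R3 → R3) : Prop :=
  HasEdgeIntegrals T (edgeIntegral u) ψ

/-- The tangential component of `u` is integrable along each edge of the mesh, so that the edge
interpolant of `u` makes sense. -/
def HasEdgeTraces (T : Geometry.SimplicialComplex ℝ R3) (u : R3 → R3) : Prop :=
  ∀ K ∈ cells T, ∀ p ∈ K, ∀ q ∈ K,
    IntervalIntegrable (fun t : ℝ => inner ℝ (u (p + t • (q - p))) (q - p)) volume 0 1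

/-! ### The scheme -/

/-- `H^{(j+1/2)}`. -/
noncomputable def half (H : ℕ → R3 → R3) (j : ℕ) : R3 → R3 :=
  fun x => (2 : ℝ)⁻¹ • (H (j + 1) x + H j x)

/-- `dt k H (j + 1)` is `d_t H^{(j+1)} = k⁻¹ (H^{(j+1)} - H^{(j)})`. -/
noncomputable def dt (k : ℝ) (H : ℕ → R3 → R3) (j : ℕ) : R3 → R3 :=
  fun x => k⁻¹ • (H j x - H (j - 1) x)

/-- The sequences `m^{(0)}, …, m^{(J)}`, `v^{(1)}, …, v^{(J)}`, `H^{(0)}, …, H^{(J)}` are produced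
by the `θ`-linear scheme with time step `k` and `J` steps on the mesh `T` of `Dt`, restricted to
`D`, from the initial data `m₀`, `H₀`. -/
structure IsSchemeOutput (Dt D : Set R3) (T : Geometry.SimplicialComplex ℝ R3)
    (lam₁ lam₂ μ σ μ₀ θ k : ℝ) (J : ℕ) (m₀ H₀ : R3 → R3) (m v H : ℕ → R3 → R3) : Prop where
  init_m : IsNodalInterpolant (restrict T D) m₀ (m 0)
  init_H : IsEdgeInterpolant T H₀ (H 0)
  mem_v : ∀ j < J, IsTangent (restrict T D) (m j) (v (j + 1))
  mem_H : ∀ j < J, IsEdgeElement T (H (j + 1))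
  llg : ∀ j < J, ∀ w : R3 → R3, IsTangent (restrict T D) (m j) w →
    lam₂ * ip D (v (j + 1)) w - lam₁ * ip D (fun x => cross (m j x) (v (j + 1) x)) w =
      -μ * gradIp D (fun x => m j x + (k * θ) • v (j + 1) x) w + μ * ip D (half H j) w
  maxwell : ∀ j < J, ∀ ζ : R3 → R3, IsEdgeElement T ζ →
    μ₀ * ip Dt (dt k H (j + 1)) ζ + σ * ip Dt (curl (half H j)) (curl ζ) =
      -μ₀ * ip Dt (D.indicator (v (j + 1))) ζ
  update : ∀ j < J, IsNodalInterpolant (restrict T D)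
    (fun x => ‖m j x + k • v (j + 1) x‖⁻¹ • (m j x + k • v (j + 1) x)) (m (j + 1))

/-- The discrete energy
`‖∇m‖²_D + ‖H‖²_Dt + λ₂ μ⁻¹ μ₀⁻¹ σ ‖∇ × H‖²_Dt`. -/
noncomputable def energy (Dt D : Set R3) (lam₂ μ σ μ₀ : ℝ) (m H : R3 → R3) : ℝ :=
  gradNormSq D m + normSq Dt H + lam₂ * μ⁻¹ * μ₀⁻¹ * σ * normSq Dt (curl H)

end MLLG

/-! The estimate comes from testing each time step with three functions and telescoping.

Testing the LLG equation with `w = v^{(j+1)}` removes the precession term, since `m × v` is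
orthogonal to `v`, and expresses `⟨∇m, ∇v⟩` through `‖v‖²`, `‖∇v‖²` and `⟨H^{(j+1/2)}, v⟩`. Testing
Maxwell's equation with `ζ = H^{(j+1/2)}` yields the increment of `‖H‖²` and the opposite multiple
of that coupling term, so the coupling cancels. Testing it with `ζ = d_t H` yields `‖d_t H‖²` and
the increment of `‖∇ × H‖²`; Young's inequality for `⟨v, d_t H⟩` then uses up half of the damping `2
λ₂ μ⁻¹ k ‖v‖²` and half of the `‖d_t H‖²` term. This is `energy_step_of_identities`.

The nodal normalization must not raise the Dirichlet energy. The stiffness matrix has zero row sums,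
so the energy is a sum of squared nodal differences weighted by minus its off-diagonal entries,
which are nonnegative by assumption. As `v ⟂ m` and `|m| = 1` at the vertices, `|m + k v| ≥ 1`
there, and radial projection does not increase distances outside the unit ball
(`gradNormSq_le_of_nodal`, `norm_normalize_sub_le`).

What is left over is `(1 - 2θ) k² ‖∇v‖²`. It is nonpositive for `θ ≥ 1/2`; otherwise the inverse
estimate `gradNormSq_le_normSq` charges it to `‖v‖²`, which is where `C₁` comes from. -/

namespace MLLG

open MeasureTheory Geometry

/-! ### Geometry of tetrahedral meshes -/

/-- The interior of the tetrahedron with vertex set `K`. -/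
def cellInterior (K : Finset R3) : Set R3 := interior (convexHull ℝ (K : Set R3))

theorem isOpen_cellInterior (K : Finset R3) : IsOpen (cellInterior K) := isOpen_interior

theorem cellInterior_subset (K : Finset R3) : cellInterior K ⊆ convexHull ℝ (K : Set R3) :=
  interior_subset

theorem isCompact_convexHull_finset (K : Finset R3) : IsCompact (convexHull ℝ (K : Set R3)) :=
  K.finite_toSet.isCompact_convexHull ℝ

theorem cellInterior_ae_eq (K : Finset R3) :
    cellInterior K =ᵐ[volume] convexHull ℝ (K : Set R3) :=
  interior_ae_eq_of_null_frontier ((convex_convexHull ℝ _).addHaar_frontier volume)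

variable {T : SimplicialComplex ℝ R3} {Ω : Set R3}

/-- By affine independence, a vertex of `K` missing from `s` lies outside the affine span of `s`,
which is therefore a proper subspace and a null set. -/
theorem volume_convexHull_ssubset {K s : Finset R3} (hK : AffineIndependent ℝ ((↑) : K → R3))
    (hs : s ⊂ K) : volume (convexHull ℝ (s : Set R3)) = 0 := by
  refine measure_mono_null (convexHull_subset_affineSpan _)
    (Measure.addHaar_affineSubspace volume _ ?_)
  have hsub := hs.subset
  obtain ⟨p, hpK, hps⟩ := Finset.exists_of_ssubset hs
  intro htop
  have h1 := hK.notMem_affineSpan_sdiff ⟨p, hpK⟩ Set.univ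
  apply h1
  have : (s : Set R3) ⊆ ((↑) : K → R3) '' (Set.univ \ {⟨p, hpK⟩}) := by
    intro q hq
    refine ⟨⟨q, hsub hq⟩, ⟨trivial, ?_⟩, rfl⟩
    intro h
    apply hps
    have : q = p := congrArg Subtype.val h
    exact this ▸ hq
  have h2 := affineSpan_mono ℝ this
  rw [htop] at h2
  exact h2 trivial

/-- Conformity puts the intersection inside the hull of `K ∩ L`, a proper face and so a null set; an
open null set is empty. -/
theorem disjoint_cellInterior {K L : Finset R3} (hK : K ∈ cells T) (hL : L ∈ cells T)
    (hKL : K ≠ L) : Disjoint (cellInterior K) (cellInterior L) := by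
  classical
  rw [Set.disjoint_iff_inter_eq_empty]
  refine ((isOpen_cellInterior K).inter (isOpen_cellInterior L)).eq_empty_of_measure_zero
    (μ := volume) ?_
  have hss : K ∩ L ⊂ K := by
    -- Both cells have four vertices, so `K ⊆ L` would force `K = L`.
    refine Finset.ssubset_iff_subset_ne.2 ⟨Finset.inter_subset_left, fun h => hKL ?_⟩
    exact Finset.eq_of_subset_of_card_le (Finset.inter_eq_left.1 h) (by rw [hK.2, hL.2])
  refine measure_mono_null ?_ (volume_convexHull_ssubset (T.indep hK.1) hss)
  rw [Finset.coe_inter]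
  exact (Set.inter_subset_inter (cellInterior_subset K) (cellInterior_subset L)).trans
    (T.inter_subset_convexHull hK.1 hL.1)

theorem cells_restrict_subset (T : SimplicialComplex ℝ R3) (D : Set R3) :
    cells (restrict T D) ⊆ cells T :=
  fun _ hK => ⟨hK.1.1, hK.2⟩

namespace IsTetrahedrization

theorem finite_cells (hT : IsTetrahedrization T Ω) : (cells T).Finite :=
  hT.finite.subset fun _ h => h.1

theorem isOpen (hT : IsTetrahedrization T Ω) : IsOpen Ω :=
  hT.interior_space ▸ isOpen_interior

theorem space_eq (hT : IsTetrahedrization T Ω) :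
    T.space = ⋃ K ∈ cells T, convexHull ℝ (K : Set R3) := by
  apply subset_antisymm
  · intro x hx
    obtain ⟨s, hs, hxs⟩ := SimplicialComplex.mem_space_iff.1 hx
    obtain ⟨K, hK, hsK⟩ := hT.pure s hs
    exact Set.mem_biUnion hK (convexHull_mono (by exact_mod_cast hsK) hxs)
  · exact Set.iUnion₂_subset fun K hK => SimplicialComplex.convexHull_subset_space hK.1

theorem exists_cell_of_vertex (hT : IsTetrahedrization T Ω) {p : R3} (hp : p ∈ T.vertices) :
    ∃ K ∈ cells T, p ∈ K := by
  obtain ⟨K, hK, h⟩ := hT.pure _ hp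
  exact ⟨K, hK, h (Finset.mem_singleton_self p)⟩

theorem finite_vertices (hT : IsTetrahedrization T Ω) : T.vertices.Finite := by
  rw [SimplicialComplex.vertices_eq]
  exact hT.finite.biUnion fun s _ => s.finite_toSet

theorem cellInterior_subset_domain (hT : IsTetrahedrization T Ω) {K : Finset R3}
    (hK : K ∈ cells T) : cellInterior K ⊆ Ω := by
  rw [← hT.interior_space]
  exact interior_mono (SimplicialComplex.convexHull_subset_space hK.1)

/-- Up to a null set the domain is the union of the open cells. -/
theorem ae_eq_biUnion (hT : IsTetrahedrization T Ω) :
    Ω =ᵐ[volume] ⋃ K ∈ hT.finite_cells.toFinset, cellInterior K := by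
  have hsub : (⋃ K ∈ hT.finite_cells.toFinset, cellInterior K) ⊆ Ω :=
    Set.iUnion₂_subset fun K hK => hT.cellInterior_subset_domain (by simpa using hK)
  refine Filter.EventuallyLE.antisymm ?_ hsub.eventuallyLE
  rw [ae_le_set]
  refine measure_mono_null (t := ⋃ K ∈ cells T, frontier (convexHull ℝ (K : Set R3))) ?_ ?_
  · rintro x ⟨hx, hx'⟩
    rw [← hT.interior_space] at hx
    have := interior_subset hx
    rw [hT.space_eq] at this
    obtain ⟨K, hK, hxK⟩ := Set.mem_iUnion₂.1 this
    refine Set.mem_biUnion hK ⟨subset_closure hxK, fun h => hx' ?_⟩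
    exact Set.mem_biUnion (by simpa using hK) h
  · rw [measure_biUnion_null_iff hT.finite_cells.countable]
    exact fun K _ => (convex_convexHull ℝ _).addHaar_frontier volume

theorem ae_of_forall_cell (hT : IsTetrahedrization T Ω) {P : R3 → Prop}
    (h : ∀ K ∈ cells T, ∀ x ∈ cellInterior K, P x) : ∀ᵐ x ∂volume.restrict Ω, P x := by
  rw [Measure.restrict_congr_set hT.ae_eq_biUnion]
  refine (ae_restrict_iff' ?_).2 (Filter.Eventually.of_forall fun x hx => ?_)
  · exact Finset.measurableSet_biUnion _ fun K _ => (isOpen_cellInterior K).measurableSet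
  · obtain ⟨K, hK, hxK⟩ := Set.mem_iUnion₂.1 hx
    exact h K (by simpa using hK) x hxK

theorem integral_eq_sum {F : Type*} [NormedAddCommGroup F] [NormedSpace ℝ F]
    (hT : IsTetrahedrization T Ω) {f : R3 → F} (hf : IntegrableOn f Ω) :
    ∫ x in Ω, f x = ∑ K ∈ hT.finite_cells.toFinset, ∫ x in cellInterior K, f x := by
  rw [Measure.restrict_congr_set hT.ae_eq_biUnion]
  refine integral_biUnion_finset _ (fun K _ => (isOpen_cellInterior K).measurableSet) ?_ ?_
  · intro K hK L hL h
    exact disjoint_cellInterior (by simpa using hK) (by simpa using hL) h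
  · intro K hK
    exact hf.mono_set (hT.cellInterior_subset_domain (by simpa using hK))

end IsTetrahedrization

/-! ### Cellwise continuous functions -/

/-- Inside each cell, `f` agrees with a continuous function on the whole space. -/
def CellwiseContinuous {F : Type*} [TopologicalSpace F] (T : SimplicialComplex ℝ R3)
    (f : R3 → F) : Prop :=
  ∀ K ∈ cells T, ∃ g : R3 → F, Continuous g ∧ Set.EqOn f g (cellInterior K)

namespace CellwiseContinuous

variable {F : Type*} [NormedAddCommGroup F]

theorem integrableOn (hT : IsTetrahedrization T Ω) {f : R3 → F} (hf : CellwiseContinuous T f) :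
    IntegrableOn f Ω := by
  rw [integrableOn_congr_set_ae hT.ae_eq_biUnion, integrableOn_finset_iUnion]
  intro K hK
  obtain ⟨g, hg, hfg⟩ := hf K (by simpa using hK)
  refine IntegrableOn.congr_fun (f := g) ?_ hfg.symm (isOpen_cellInterior K).measurableSet
  exact (hg.continuousOn.integrableOn_compact (isCompact_convexHull_finset K)).mono_set
    (cellInterior_subset K)

theorem restrict {f : R3 → F} (hf : CellwiseContinuous T f) (D : Set R3) :
    CellwiseContinuous (restrict T D) f :=
  fun K hK => hf K (cells_restrict_subset T D hK)

theorem add {f g : R3 → F} (hf : CellwiseContinuous T f) (hg : CellwiseContinuous T g) :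
    CellwiseContinuous T (fun x => f x + g x) := by
  intro K hK
  obtain ⟨f', hf', hff⟩ := hf K hK
  obtain ⟨g', hg', hgg⟩ := hg K hK
  exact ⟨fun x => f' x + g' x, hf'.add hg', fun x hx => by simp only [hff hx, hgg hx]⟩

theorem inner [InnerProductSpace ℝ F] {f g : R3 → F} (hf : CellwiseContinuous T f)
    (hg : CellwiseContinuous T g) :
    CellwiseContinuous T (fun x => inner ℝ (f x) (g x)) := by
  intro K hK
  obtain ⟨f', hf', hff⟩ := hf K hK
  obtain ⟨g', hg', hgg⟩ := hg K hK
  exact ⟨fun x => Inner.inner ℝ (f' x) (g' x), hf'.inner hg',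
    fun x hx => by simp only [hff hx, hgg hx]⟩

theorem smul [NormedSpace ℝ F] {f : R3 → F} (hf : CellwiseContinuous T f) (c : ℝ) :
    CellwiseContinuous T (fun x => c • f x) := by
  intro K hK
  obtain ⟨f', hf', hff⟩ := hf K hK
  exact ⟨fun x => c • f' x, hf'.const_smul c, fun x hx => by simp only [hff hx]⟩

end CellwiseContinuous

/-! ### Bilinearity of the `L²` products -/

section ip

variable {F : Type*} [NormedAddCommGroup F] [InnerProductSpace ℝ F] {u v w : R3 → F}

/-- Agreement inside the cells is enough because the cell boundaries are null. This matters for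
derivatives and for edge elements, which are controlled only there. -/
theorem ip_congr (hT : IsTetrahedrization T Ω) {u' w' : R3 → F}
    (hu : ∀ K ∈ cells T, Set.EqOn u u' (cellInterior K))
    (hw : ∀ K ∈ cells T, Set.EqOn w w' (cellInterior K)) : ip Ω u w = ip Ω u' w' := by
  refine integral_congr_ae (hT.ae_of_forall_cell fun K hK x hx => ?_)
  simp only [hu K hK hx, hw K hK hx]

theorem ip_comm (Ω : Set R3) (u w : R3 → F) : ip Ω u w = ip Ω w u := by
  simp only [ip, real_inner_comm]

theorem ip_add_left (hT : IsTetrahedrization T Ω) (hu : CellwiseContinuous T u)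
    (hv : CellwiseContinuous T v) (hw : CellwiseContinuous T w) :
    ip Ω (fun x => u x + v x) w = ip Ω u w + ip Ω v w := by
  simp only [ip, inner_add_left]
  exact integral_add ((hu.inner hw).integrableOn hT) ((hv.inner hw).integrableOn hT)

theorem ip_smul_left (Ω : Set R3) (c : ℝ) (u w : R3 → F) :
    ip Ω (fun x => c • u x) w = c * ip Ω u w := by
  simp only [ip, real_inner_smul_left]
  exact integral_const_mul _ _

theorem ip_add_right (hT : IsTetrahedrization T Ω) (hu : CellwiseContinuous T u)
    (hv : CellwiseContinuous T v) (hw : CellwiseContinuous T w) :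
    ip Ω w (fun x => u x + v x) = ip Ω w u + ip Ω w v := by
  rw [ip_comm, ip_add_left hT hu hv hw, ip_comm Ω u, ip_comm Ω v]

theorem ip_smul_right (Ω : Set R3) (c : ℝ) (u w : R3 → F) :
    ip Ω w (fun x => c • u x) = c * ip Ω w u := by
  rw [ip_comm, ip_smul_left, ip_comm]

theorem normSq_nonneg (Ω : Set R3) (u : R3 → F) : 0 ≤ normSq Ω u :=
  integral_nonneg fun _ => real_inner_self_nonneg

theorem gradNormSq_nonneg (Ω : Set R3) (u : R3 → F) : 0 ≤ gradNormSq Ω u := by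
  rw [gradNormSq, gradIp]
  exact Finset.sum_nonneg fun i _ => normSq_nonneg Ω (pderiv i u)

/-- `‖u + c w‖² = ‖u‖² + 2 c ⟨u, w⟩ + c² ‖w‖²`. -/
theorem normSq_add_smul (hT : IsTetrahedrization T Ω) (hu : CellwiseContinuous T u)
    (hw : CellwiseContinuous T w) (c : ℝ) :
    normSq Ω (fun x => u x + c • w x) = normSq Ω u + 2 * c * ip Ω u w + c ^ 2 * normSq Ω w := by
  have hcw := hw.smul c
  simp only [normSq]
  rw [ip_add_left hT hu hcw (hu.add hcw), ip_add_right hT hu hcw hu, ip_add_right hT hu hcw hcw,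
    ip_smul_right, ip_smul_left, ip_smul_left, ip_smul_right, ip_comm Ω w u]
  ring

/-- Young's inequality for the `L²` product. -/
theorem neg_two_mul_ip_le (hT : IsTetrahedrization T Ω) (hu : CellwiseContinuous T u)
    (hw : CellwiseContinuous T w) : -(2 * ip Ω u w) ≤ normSq Ω u + normSq Ω w := by
  have h := normSq_add_smul hT hu hw 1
  have h0 := normSq_nonneg Ω (fun x => u x + (1 : ℝ) • w x)
  linarith

end ip

/-! ### Piecewise linear functions -/

section P1

variable {F : Type*} [NormedAddCommGroup F] [NormedSpace ℝ F]

theorem pderiv_congr {u w : R3 → F} {U : Set R3} (hU : IsOpen U) (h : Set.EqOn u w U)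
    {x : R3} (hx : x ∈ U) (i : Fin 3) : pderiv i u x = pderiv i w x := by
  unfold pderiv
  rw [Filter.EventuallyEq.fderiv_eq (h.eventuallyEq_of_mem (hU.mem_nhds hx))]

theorem affineMap_hasFDerivAt (A : R3 →ᵃ[ℝ] F) (x : R3) :
    HasFDerivAt A (LinearMap.toContinuousLinearMap A.linear) x := by
  have h : (A : R3 → F) = fun y => LinearMap.toContinuousLinearMap A.linear y + A 0 := by
    ext y
    have := A.linearMap_vsub y 0
    simp only [vsub_eq_sub, sub_zero] at this
    simp [this]
  rw [h]
  exact (LinearMap.toContinuousLinearMap A.linear).hasFDerivAt.add_const _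

theorem pderiv_affineMap (A : R3 →ᵃ[ℝ] F) (i : Fin 3) (x : R3) :
    pderiv i A x = A.linear (EuclideanSpace.single i 1) := by
  unfold pderiv
  rw [(affineMap_hasFDerivAt A x).fderiv]
  rfl

theorem affineMap_eqOn_convexHull {A B : R3 →ᵃ[ℝ] F} {s : Set R3} (h : Set.EqOn A B s) :
    Set.EqOn A B (convexHull ℝ s) := by
  have hc : Convex ℝ {x | A x = B x} := by
    intro x hx y hy a b ha hb hab
    change A x = B x at hx
    change A y = B y at hy
    change A _ = B _
    rw [Convex.combo_affine_apply hab, Convex.combo_affine_apply hab, hx, hy]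
  exact fun x hx => convexHull_min h hc hx

namespace IsP1

variable {u w : R3 → F}

theorem cellwiseContinuous (hu : IsP1 T u) : CellwiseContinuous T u := by
  intro K hK
  obtain ⟨A, hA⟩ := hu.affine K hK
  exact ⟨A, A.continuous_of_finiteDimensional, hA.mono (cellInterior_subset K)⟩

theorem pderiv_eqOn {K : Finset R3} {A : R3 →ᵃ[ℝ] F}
    (hA : Set.EqOn u A (convexHull ℝ (K : Set R3))) (i : Fin 3) :
    Set.EqOn (pderiv i u) (fun _ => A.linear (EuclideanSpace.single i 1)) (cellInterior K) := by
  intro x hx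
  rw [pderiv_congr (isOpen_cellInterior K) (hA.mono (cellInterior_subset K)) hx, pderiv_affineMap]

theorem cellwiseContinuous_pderiv (hu : IsP1 T u) (i : Fin 3) :
    CellwiseContinuous T (pderiv i u) := by
  intro K hK
  obtain ⟨A, hA⟩ := hu.affine K hK
  exact ⟨_, continuous_const, pderiv_eqOn hA i⟩

theorem const (T : SimplicialComplex ℝ R3) (c : F) : IsP1 T (fun _ => c) :=
  ⟨continuousOn_const, fun _ _ => ⟨AffineMap.const ℝ R3 c, fun _ _ => rfl⟩⟩

theorem add_smul (hu : IsP1 T u) (hw : IsP1 T w) (c : ℝ) : IsP1 T (fun x => u x + c • w x) := by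
  refine ⟨hu.continuousOn.add (hw.continuousOn.const_smul c), fun K hK => ?_⟩
  obtain ⟨A, hA⟩ := hu.affine K hK
  obtain ⟨B, hB⟩ := hw.affine K hK
  refine ⟨A + c • B, fun x hx => ?_⟩
  simp [hA hx, hB hx]

theorem pderiv_add_smul (hu : IsP1 T u) (hw : IsP1 T w) (c : ℝ) (i : Fin 3) {K : Finset R3}
    (hK : K ∈ cells T) :
    Set.EqOn (pderiv i (fun x => u x + c • w x)) (fun x => pderiv i u x + c • pderiv i w x)
      (cellInterior K) := by
  intro x hx
  obtain ⟨A, hA⟩ := hu.affine K hK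
  obtain ⟨B, hB⟩ := hw.affine K hK
  have hAB : Set.EqOn (fun x => u x + c • w x) (A + c • B : R3 →ᵃ[ℝ] F)
      (convexHull ℝ (K : Set R3)) := fun x hx => by simp [hA hx, hB hx]
  simp only [pderiv_eqOn hAB i hx, pderiv_eqOn hA i hx, pderiv_eqOn hB i hx]
  rfl

end IsP1

end P1

section gradIp

variable {F : Type*} [NormedAddCommGroup F] [InnerProductSpace ℝ F] {u v w : R3 → F}

theorem gradIp_comm (Ω : Set R3) (u w : R3 → F) : gradIp Ω u w = gradIp Ω w u := by
  simp only [gradIp, ip_comm]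

theorem gradIp_add_smul_left (hT : IsTetrahedrization T Ω) (hu : IsP1 T u) (hv : IsP1 T v)
    (hw : IsP1 T w) (c : ℝ) :
    gradIp Ω (fun x => u x + c • v x) w = gradIp Ω u w + c * gradIp Ω v w := by
  simp only [gradIp, Finset.mul_sum, ← Finset.sum_add_distrib]
  refine Finset.sum_congr rfl fun i _ => ?_
  rw [ip_congr hT (fun K hK => hu.pderiv_add_smul hv c i hK) (fun K _ => Set.eqOn_refl _ _),
    ip_add_left hT (hu.cellwiseContinuous_pderiv i) ((hv.cellwiseContinuous_pderiv i).smul c)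
      (hw.cellwiseContinuous_pderiv i), ip_smul_left]

theorem gradNormSq_add_smul (hT : IsTetrahedrization T Ω) (hu : IsP1 T u) (hw : IsP1 T w)
    (c : ℝ) :
    gradNormSq Ω (fun x => u x + c • w x) =
      gradNormSq Ω u + 2 * c * gradIp Ω u w + c ^ 2 * gradNormSq Ω w := by
  rw [gradNormSq, gradIp_add_smul_left hT hu hw (hu.add_smul hw c), gradIp_comm Ω u,
    gradIp_comm Ω w, gradIp_add_smul_left hT hu hw hu, gradIp_add_smul_left hT hu hw hw,
    gradIp_comm Ω w u, gradNormSq, gradNormSq]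
  ring

end gradIp

/-! ### Nodal basis functions -/

/-- Four affinely independent points form an affine basis of the space, and the barycentric
coordinate of `p` is the required map. If `p` is not a vertex of `K`, zero serves. -/
theorem exists_affineMap_hat {K : Finset R3} (hK : K ∈ cells T) (p : R3) :
    ∃ A : R3 →ᵃ[ℝ] ℝ, ∀ q ∈ K, (q = p → A q = 1) ∧ (q ≠ p → A q = 0) := by
  have hind := T.indep hK.1
  have htop : affineSpan ℝ (Set.range ((↑) : K → R3)) = ⊤ := by
    rw [hind.affineSpan_eq_top_iff_card_eq_finrank_add_one]
    simp [hK.2]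
  let b : AffineBasis K ℝ R3 := ⟨(↑), hind, htop⟩
  have hb : ∀ q : K, b q = q := fun _ => rfl
  by_cases hp : p ∈ K
  · refine ⟨b.coord ⟨p, hp⟩, fun q hq => ⟨?_, fun hqp => ?_⟩⟩
    · rintro rfl
      exact b.coord_apply_eq ⟨q, hp⟩
    · refine b.coord_apply_ne (i := ⟨p, hp⟩) (j := ⟨q, hq⟩) fun h => hqp ?_
      exact (congrArg Subtype.val h).symm
  · refine ⟨AffineMap.const ℝ R3 0, fun q hq => ⟨?_, fun _ => rfl⟩⟩
    rintro rfl
    exact absurd hq hp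

/-- The sign condition on the stiffness matrix speaks of hat functions, so they have to be produced.
They are glued from barycentric coordinates, continuity holding because the cells are finitely many
closed sets. -/
theorem exists_isHat (hT : IsTetrahedrization T Ω) {p : R3} (hp : p ∈ T.vertices) :
    ∃ φ : R3 → ℝ, IsHat T p φ := by
  classical
  have hA : ∀ K : Finset R3, ∃ A : R3 →ᵃ[ℝ] ℝ, K ∈ cells T →
      ∀ q ∈ K, (q = p → A q = 1) ∧ (q ≠ p → A q = 0) := by
    intro K
    by_cases hK : K ∈ cells T
    · obtain ⟨A, hA⟩ := exists_affineMap_hat hK p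
      exact ⟨A, fun _ => hA⟩
    · exact ⟨0, fun h => absurd h hK⟩
  choose A hA using hA
  -- Two cells meet only in the hull of their common vertices, where affine maps with equal vertex
  -- values coincide.
  have hcompat : ∀ K ∈ cells T, ∀ L ∈ cells T, ∀ x ∈ convexHull ℝ (K : Set R3),
      x ∈ convexHull ℝ (L : Set R3) → A K x = A L x := by
    intro K hK L hL x hxK hxL
    refine affineMap_eqOn_convexHull (s := (K : Set R3) ∩ L) ?_
      (T.inter_subset_convexHull hK.1 hL.1 ⟨hxK, hxL⟩)
    rintro q ⟨hqK, hqL⟩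
    by_cases hqp : q = p
    · rw [(hA K hK q hqK).1 hqp, (hA L hL q hqL).1 hqp]
    · rw [(hA K hK q hqK).2 hqp, (hA L hL q hqL).2 hqp]
  let φ : R3 → ℝ := fun x =>
    if h : ∃ K ∈ cells T, x ∈ convexHull ℝ (K : Set R3) then A h.choose x else 0
  have hφ : ∀ K ∈ cells T, Set.EqOn φ (A K) (convexHull ℝ (K : Set R3)) := by
    intro K hK x hx
    have h : ∃ K ∈ cells T, x ∈ convexHull ℝ (K : Set R3) := ⟨K, hK, hx⟩
    simp only [φ, dif_pos h]
    exact hcompat _ h.choose_spec.1 K hK x h.choose_spec.2 hx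
  refine ⟨φ, ⟨⟨?_, fun K hK => ⟨A K, hφ K hK⟩⟩, ?_, ?_⟩⟩
  · rw [hT.space_eq, Set.biUnion_eq_iUnion]
    have := hT.finite_cells.to_subtype
    refine (locallyFinite_of_finite _).continuousOn_iUnion
      (fun K => (isCompact_convexHull_finset K).isClosed) fun K => ?_
    exact ((A K).continuous_of_finiteDimensional.continuousOn).congr (hφ K K.2)
  · obtain ⟨K, hK, hpK⟩ := hT.exists_cell_of_vertex hp
    rw [hφ K hK (subset_convexHull ℝ _ hpK)]
    exact (hA K hK p hpK).1 rfl
  · intro q hq hqp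
    obtain ⟨K, hK, hqK⟩ := hT.exists_cell_of_vertex hq
    rw [hφ K hK (subset_convexHull ℝ _ hqK)]
    exact (hA K hK q hqK).2 hqp

theorem mem_vertices_of_mem_cell {K : Finset R3} (hK : K ∈ cells T) {p : R3} (hp : p ∈ K) :
    p ∈ T.vertices :=
  T.down_closed hK.1 (Finset.singleton_subset_iff.2 hp) (Finset.singleton_nonempty p)

/-- Inside the cells, the derivatives of a piecewise linear function are the combinations of the
derivatives of the nodal basis functions with the nodal values as coefficients. -/
theorem IsP1.pderiv_eq_sum {F : Type*} [NormedAddCommGroup F] [NormedSpace ℝ F]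
    {u : R3 → F} (hu : IsP1 T u) {V : Finset R3} (hV : (V : Set R3) = T.vertices)
    {φ : R3 → R3 → ℝ} (hφ : ∀ p ∈ V, IsHat T p (φ p)) (i : Fin 3) {K : Finset R3}
    (hK : K ∈ cells T) :
    Set.EqOn (pderiv i u) (fun x => ∑ p ∈ V, pderiv i (φ p) x • u p) (cellInterior K) := by
  classical
  have hB : ∀ p : R3, ∃ B : R3 →ᵃ[ℝ] ℝ, p ∈ V → Set.EqOn (φ p) B (convexHull ℝ (K : Set R3)) := by
    intro p
    by_cases hp : p ∈ V
    · obtain ⟨B, hB⟩ := (hφ p hp).isP1.affine K hK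
      exact ⟨B, fun _ => hB⟩
    · exact ⟨0, fun h => absurd h hp⟩
  choose B hB using hB
  obtain ⟨A, hA⟩ := hu.affine K hK
  -- The combination of the hat functions on `K`, as a single affine map; it will equal `A` because
  -- both agree at the vertices of `K`.
  obtain ⟨S, hS⟩ : ∃ S : R3 →ᵃ[ℝ] F, ∀ x, S x = ∑ p ∈ V, B p x • u p := by
    clear hV hφ hB
    induction V using Finset.induction_on with
    | empty => exact ⟨0, fun x => by simp⟩
    | insert p V hp ih =>
      obtain ⟨S, hS⟩ := ih
      refine ⟨(LinearMap.toSpanSingleton ℝ F (u p)).toAffineMap.comp (B p) + S, fun x => ?_⟩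
      simp [Finset.sum_insert hp, hS]
  have hSl : ∀ y, S.linear y = ∑ p ∈ V, (B p).linear y • u p := by
    intro y
    have h1 : S.linear y = S y - S 0 := by
      have := S.linearMap_vsub y 0
      simpa using this
    rw [h1, hS, hS, ← Finset.sum_sub_distrib]
    refine Finset.sum_congr rfl fun p _ => ?_
    have := (B p).linearMap_vsub y 0
    simp only [vsub_eq_sub, sub_zero] at this
    rw [this, sub_smul]
  have hAS : Set.EqOn A S (convexHull ℝ (K : Set R3)) := by
    refine affineMap_eqOn_convexHull fun q hq => ?_
    have hqV : q ∈ V := by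
      have : q ∈ (V : Set R3) := hV ▸ mem_vertices_of_mem_cell hK hq
      exact this
    have hqK := subset_convexHull ℝ (K : Set R3) hq
    rw [← hA hqK, hS, Finset.sum_eq_single q]
    · rw [← hB q hqV hqK, (hφ q hqV).self, one_smul]
    · intro p hp hpq
      rw [← hB p hp hqK, (hφ p hp).other q (hV ▸ hqV) hpq.symm, zero_smul]
    · exact fun h => absurd hqV h
  intro x hx
  rw [IsP1.pderiv_eqOn (hA.trans hAS) i hx]
  simp only [hSl]
  exact Finset.sum_congr rfl fun p hp => by rw [IsP1.pderiv_eqOn (hB p hp) i hx]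

/-! ### Nodal normalization decreases the Dirichlet energy -/

section stiffness

variable {ι F : Type*} [NormedAddCommGroup F] [InnerProductSpace ℝ F]

/-- Expanding `‖u p - u q‖²`, the two diagonal contributions vanish by the zero row and column sums.
Only nodal differences remain, so off-diagonal signs decide monotonicity. -/
theorem sum_mul_inner_eq_of_sum_eq_zero {V : Finset ι} {a : ι → ι → ℝ}
    (hrow : ∀ p ∈ V, ∑ q ∈ V, a p q = 0) (hcol : ∀ q ∈ V, ∑ p ∈ V, a p q = 0) (u : ι → F) :
    ∑ p ∈ V, ∑ q ∈ V, a p q * inner ℝ (u p) (u q) =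
      -(2⁻¹ * ∑ p ∈ V, ∑ q ∈ V, a p q * ‖u p - u q‖ ^ 2) := by
  have h1 : ∑ p ∈ V, ∑ q ∈ V, a p q * ‖u p‖ ^ 2 = 0 :=
    Finset.sum_eq_zero fun p hp => by rw [← Finset.sum_mul, hrow p hp, zero_mul]
  have h2 : ∑ p ∈ V, ∑ q ∈ V, a p q * ‖u q‖ ^ 2 = 0 := by
    rw [Finset.sum_comm]
    exact Finset.sum_eq_zero fun q hq => by rw [← Finset.sum_mul, hcol q hq, zero_mul]
  have h3 : ∑ p ∈ V, ∑ q ∈ V, a p q * ‖u p - u q‖ ^ 2 =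
      ∑ p ∈ V, ∑ q ∈ V, a p q * ‖u p‖ ^ 2 - 2 * ∑ p ∈ V, ∑ q ∈ V, a p q * inner ℝ (u p) (u q)
        + ∑ p ∈ V, ∑ q ∈ V, a p q * ‖u q‖ ^ 2 := by
    simp only [Finset.mul_sum, ← Finset.sum_sub_distrib, ← Finset.sum_add_distrib]
    refine Finset.sum_congr rfl fun p _ => Finset.sum_congr rfl fun q _ => ?_
    rw [norm_sub_sq_real]
    ring
  rw [h3, h1, h2]
  ring

theorem norm_normalize_sub_le {x y : F} (hx : 1 ≤ ‖x‖) (hy : 1 ≤ ‖y‖) :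
    ‖‖x‖⁻¹ • x - ‖y‖⁻¹ • y‖ ≤ ‖x - y‖ := by
  have hx0 : 0 < ‖x‖ := by linarith
  have hy0 : 0 < ‖y‖ := by linarith
  refine le_of_sq_le_sq ?_ (norm_nonneg _)
  rw [norm_sub_sq_real, norm_sub_sq_real, real_inner_smul_left, real_inner_smul_right, norm_smul,
    norm_smul, norm_inv, norm_inv, norm_norm, norm_norm, inv_mul_cancel₀ hx0.ne',
    inv_mul_cancel₀ hy0.ne']
  have hc := real_inner_le_norm x y
  set c := inner ℝ x y
  have hxy : 1 ≤ ‖x‖ * ‖y‖ := one_le_mul_of_one_le_of_one_le hx hy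
  have hle : ‖x‖⁻¹ * (‖y‖⁻¹ * c) ≤ 1 := by
    rw [← mul_assoc, ← mul_inv, inv_mul_le_iff₀ (by positivity)]
    linarith
  have hceq : c = ‖x‖ * ‖y‖ * (‖x‖⁻¹ * (‖y‖⁻¹ * c)) := by field_simp
  set d := ‖x‖⁻¹ * (‖y‖⁻¹ * c)
  rw [hceq]
  -- With `d` the cosine of the angle, the difference of the two sides is `(‖x‖ - ‖y‖)² + 2 (‖x‖ ‖y‖
  -- - 1) (1 - d)`.
  nlinarith [sq_nonneg (‖x‖ - ‖y‖), mul_nonneg (sub_nonneg.2 hxy) (sub_nonneg.2 hle)]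

/-- The Dirichlet energy of a piecewise linear function in terms of the stiffness matrix. -/
theorem gradNormSq_eq_sum (hT : IsTetrahedrization T Ω) {V : Finset R3}
    (hV : (V : Set R3) = T.vertices) {φ : R3 → R3 → ℝ} (hφ : ∀ p ∈ V, IsHat T p (φ p))
    {u : R3 → F} (hu : IsP1 T u) :
    gradNormSq Ω u = ∑ p ∈ V, ∑ q ∈ V, gradIp Ω (φ p) (φ q) * inner ℝ (u p) (u q) := by
  have key : ∀ i : Fin 3, ip Ω (pderiv i u) (pderiv i u) =
      ∑ p ∈ V, ∑ q ∈ V, ip Ω (pderiv i (φ p)) (pderiv i (φ q)) * inner ℝ (u p) (u q) := by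
    intro i
    rw [ip_congr hT (fun K hK => hu.pderiv_eq_sum hV hφ i hK)
      (fun K hK => hu.pderiv_eq_sum hV hφ i hK)]
    have hint : ∀ p ∈ V, ∀ q ∈ V, IntegrableOn (fun x =>
        inner ℝ (pderiv i (φ p) x) (pderiv i (φ q) x) * inner ℝ (u p) (u q)) Ω := by
      intro p hp q hq
      exact ((((hφ p hp).isP1.cellwiseContinuous_pderiv i).inner
        ((hφ q hq).isP1.cellwiseContinuous_pderiv i)).integrableOn hT).mul_const _
    have hpt : ∀ x, inner ℝ (∑ p ∈ V, pderiv i (φ p) x • u p) (∑ p ∈ V, pderiv i (φ p) x • u p) =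
        ∑ p ∈ V, ∑ q ∈ V,
          inner ℝ (pderiv i (φ p) x) (pderiv i (φ q) x) * inner ℝ (u p) (u q) := by
      intro x
      rw [sum_inner]
      refine Finset.sum_congr rfl fun p _ => ?_
      rw [inner_sum]
      refine Finset.sum_congr rfl fun q _ => ?_
      rw [real_inner_smul_left, real_inner_smul_right, real_inner_eq_re_inner]
      simp
      ring
    simp only [ip, hpt]
    rw [integral_finsetSum _ fun p hp => integrable_finsetSum _ fun q hq => hint p hp q hq]
    refine Finset.sum_congr rfl fun p hp => ?_
    rw [integral_finsetSum _ fun q hq => hint p hp q hq]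
    exact Finset.sum_congr rfl fun q hq => integral_mul_const _ _
  rw [gradNormSq, gradIp, Finset.sum_congr rfl fun i _ => key i, Finset.sum_comm]
  refine Finset.sum_congr rfl fun p _ => ?_
  rw [Finset.sum_comm]
  refine Finset.sum_congr rfl fun q _ => ?_
  rw [gradIp, Finset.sum_mul]

/-- The hat functions sum to the constant `1`, whose gradient is zero. -/
theorem sum_gradIp_hat_eq_zero (hT : IsTetrahedrization T Ω) {V : Finset R3}
    (hV : (V : Set R3) = T.vertices) {φ : R3 → R3 → ℝ} (hφ : ∀ p ∈ V, IsHat T p (φ p))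
    {p : R3} (hp : p ∈ V) : ∑ q ∈ V, gradIp Ω (φ p) (φ q) = 0 := by
  simp only [gradIp]
  rw [Finset.sum_comm]
  refine Finset.sum_eq_zero fun i _ => ?_
  simp only [ip]
  rw [← integral_finsetSum _ fun q hq => (((hφ p hp).isP1.cellwiseContinuous_pderiv i).inner
    ((hφ q hq).isP1.cellwiseContinuous_pderiv i)).integrableOn hT]
  refine integral_eq_zero_of_ae (hT.ae_of_forall_cell fun K hK x hx => ?_)
  have h := (IsP1.const T (1 : ℝ)).pderiv_eq_sum hV hφ i hK hx
  simp only [smul_eq_mul, mul_one] at h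
  change ∑ q ∈ V, inner ℝ (pderiv i (φ p) x) (pderiv i (φ q) x) = (0 : ℝ)
  rw [← inner_sum, ← h]
  simp [pderiv]

theorem gradNormSq_le_of_nodal (hT : IsTetrahedrization T Ω) (hst : HasNonposStiffness T Ω)
    {u w : R3 → F} (hu : IsP1 T u) (hw : IsP1 T w)
    (hle : ∀ p ∈ T.vertices, ∀ q ∈ T.vertices, ‖w p - w q‖ ≤ ‖u p - u q‖) :
    gradNormSq Ω w ≤ gradNormSq Ω u := by
  have hV : (hT.finite_vertices.toFinset : Set R3) = T.vertices := by simp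
  set V := hT.finite_vertices.toFinset
  have hmem : ∀ p ∈ V, p ∈ T.vertices := fun p hp => hV ▸ hp
  have hφ : ∀ p : R3, ∃ φ : R3 → ℝ, p ∈ V → IsHat T p φ := by
    intro p
    by_cases hp : p ∈ V
    · obtain ⟨φ, h⟩ := exists_isHat hT (hmem p hp)
      exact ⟨φ, fun _ => h⟩
    · exact ⟨0, fun h => absurd h hp⟩
  choose φ hφ using hφ
  have hrow := fun p (hp : p ∈ V) => sum_gradIp_hat_eq_zero hT hV hφ hp
  have hcol : ∀ q ∈ V, ∑ p ∈ V, gradIp Ω (φ p) (φ q) = 0 := fun q hq => by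
    rw [← hrow q hq]
    exact Finset.sum_congr rfl fun p _ => gradIp_comm _ _ _
  rw [gradNormSq_eq_sum hT hV hφ hu, gradNormSq_eq_sum hT hV hφ hw,
    sum_mul_inner_eq_of_sum_eq_zero hrow hcol, sum_mul_inner_eq_of_sum_eq_zero hrow hcol]
  have : ∑ p ∈ V, ∑ q ∈ V, gradIp Ω (φ p) (φ q) * ‖u p - u q‖ ^ 2 ≤
      ∑ p ∈ V, ∑ q ∈ V, gradIp Ω (φ p) (φ q) * ‖w p - w q‖ ^ 2 := by
    -- Diagonal terms vanish; off the diagonal the weights are nonpositive, which reverses the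
    -- inequality between the differences.
    refine Finset.sum_le_sum fun p hp => Finset.sum_le_sum fun q hq => ?_
    by_cases hpq : p = q
    · simp [hpq]
    · refine mul_le_mul_of_nonpos_left ?_
        (hst p (hmem p hp) q (hmem q hq) hpq _ _ (hφ p hp) (hφ q hq))
      exact pow_le_pow_left₀ (norm_nonneg _) (hle p (hmem p hp) q (hmem q hq)) 2
  linarith

end stiffness

/-! ### The inverse estimate -/

section inverse

variable {F : Type*} [NormedAddCommGroup F] [InnerProductSpace ℝ F]

/-- A bound for the gradient of an affine function by its values on a ball. -/
theorem sq_mul_norm_linear_sq_le (A : R3 →ᵃ[ℝ] F) {S : Set R3} (hS : IsCompact S) {c : R3} {r : ℝ}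
    (hr : 0 < r) (hball : Metric.ball c r ⊆ S) (i : Fin 3) :
    r ^ 2 * (volume.real (Metric.ball c (r / 2)) * ‖A.linear (EuclideanSpace.single i 1)‖ ^ 2) ≤
      16 * ∫ x in S, ‖A x‖ ^ 2 := by
  set G := A.linear (EuclideanSpace.single i 1)
  -- A shift by `r / 2` keeps the half-size ball inside the ball of radius `r`, and changes `A` by
  -- exactly `(r / 2) • G`.
  set e : R3 := (r / 2) • EuclideanSpace.single i 1
  have he : ‖e‖ = r / 2 := by simp [e, norm_smul, abs_of_pos hr]
  have hcont : Continuous A := A.continuous_of_finiteDimensional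
  have hint : IntegrableOn (fun x => ‖A x‖ ^ 2) S :=
    (hcont.norm.pow 2).continuousOn.integrableOn_compact hS
  have hnn : ∀ (s : Set R3), 0 ≤ᵐ[volume.restrict s] fun x => ‖A x‖ ^ 2 :=
    fun s => Filter.Eventually.of_forall fun x => sq_nonneg _
  have hsub : Metric.ball c (r / 2) ⊆ Metric.ball c r := Metric.ball_subset_ball (by linarith)
  have hpre : Metric.ball c (r / 2) ⊆ (fun x => x + e) ⁻¹' Metric.ball c r := by
    intro x hx
    rw [Set.mem_preimage, Metric.mem_ball, dist_eq_norm] at *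
    calc ‖x + e - c‖ = ‖(x - c) + e‖ := by congr 1; abel
      _ ≤ ‖x - c‖ + ‖e‖ := norm_add_le _ _
      _ < r := by linarith
  have hme : MeasurableEmbedding (fun x : R3 => x + e) := measurableEmbedding_addRight e
  have hmp : MeasurePreserving (fun x : R3 => x + e) volume volume :=
    measurePreserving_add_right volume e
  have hint2 : IntegrableOn (fun x => ‖A (x + e)‖ ^ 2)
      ((fun x => x + e) ⁻¹' Metric.ball c r) :=
    (hmp.integrableOn_comp_preimage hme (f := fun x => ‖A x‖ ^ 2)).2 (hint.mono_set hball)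
  have h1 : ∫ x in Metric.ball c (r / 2), ‖A x‖ ^ 2 ≤ ∫ x in S, ‖A x‖ ^ 2 :=
    setIntegral_mono_set hint (hnn S) (hsub.trans hball).eventuallyLE
  have h2 : ∫ x in Metric.ball c (r / 2), ‖A (x + e)‖ ^ 2 ≤ ∫ x in S, ‖A x‖ ^ 2 := by
    calc ∫ x in Metric.ball c (r / 2), ‖A (x + e)‖ ^ 2
        ≤ ∫ x in (fun x => x + e) ⁻¹' Metric.ball c r, ‖A (x + e)‖ ^ 2 :=
          setIntegral_mono_set hint2 (Filter.Eventually.of_forall fun x => sq_nonneg _)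
            hpre.eventuallyLE
      _ = ∫ x in Metric.ball c r, ‖A x‖ ^ 2 :=
          hmp.setIntegral_preimage_emb hme (fun x => ‖A x‖ ^ 2) _
      _ ≤ ∫ x in S, ‖A x‖ ^ 2 := setIntegral_mono_set hint (hnn S) hball.eventuallyLE
  have hpt : ∀ x, (r / 2) ^ 2 * ‖G‖ ^ 2 ≤ 2 * ‖A (x + e)‖ ^ 2 + 2 * ‖A x‖ ^ 2 := by
    intro x
    have hd : A (x + e) - A x = (r / 2) • G := by
      have := A.linearMap_vsub (x + e) x
      simp only [vsub_eq_sub, add_sub_cancel_left] at this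
      rw [← this]
      simp [e, G]
    have hn : ‖A (x + e) - A x‖ = r / 2 * ‖G‖ := by
      rw [hd, norm_smul, Real.norm_of_nonneg (by linarith)]
    have hle := norm_sub_le (A (x + e)) (A x)
    rw [hn] at hle
    have h0 : 0 ≤ r / 2 * ‖G‖ := by positivity
    nlinarith [sq_nonneg (‖A (x + e)‖ - ‖A x‖), norm_nonneg (A x), norm_nonneg (A (x + e))]
  have hi1 : IntegrableOn (fun x => 2 * ‖A (x + e)‖ ^ 2) (Metric.ball c (r / 2)) :=
    (hint2.mono_set hpre).const_mul 2
  have hi2 : IntegrableOn (fun x => 2 * ‖A x‖ ^ 2) (Metric.ball c (r / 2)) :=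
    (hint.mono_set (hsub.trans hball)).const_mul 2
  -- Integrating the pointwise bound gives `(r² / 4) |B| ‖G‖² ≤ 4 ∫ ‖A‖²`, with `B` the half-size
  -- ball; hence the factor 16.
  have h3 : ∫ _ in Metric.ball c (r / 2), (r / 2) ^ 2 * ‖G‖ ^ 2 ≤
      ∫ x in Metric.ball c (r / 2), (2 * ‖A (x + e)‖ ^ 2 + 2 * ‖A x‖ ^ 2) := by
    refine setIntegral_mono ?_ (hi1.add hi2) hpt
    exact integrableOn_const (by exact measure_ball_lt_top.ne)
  rw [setIntegral_const, smul_eq_mul, integral_add hi1 hi2, integral_const_mul,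
    integral_const_mul] at h3
  nlinarith

theorem IsMeshSize.pos {h : ℝ} (hh : IsMeshSize T h) : 0 < h := by
  obtain ⟨K, hK, rfl⟩ := hh.1
  obtain ⟨p, hp, q, hq, hpq⟩ := Finset.one_lt_card.1 (by rw [hK.2]; norm_num : 1 < K.card)
  exact (dist_pos.2 hpq).trans_le (Metric.dist_le_diam_of_mem
    (isCompact_convexHull_finset K).isBounded (subset_convexHull ℝ _ hp)
    (subset_convexHull ℝ _ hq))

/-- The cell lies in a closed ball of radius `h` about one of its vertices; `8 / κ³` is the cubed
ratio of `h` to `κ h / 2`. -/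
theorem volume_cell_le {κ h : ℝ} (hκ : 0 < κ) (hh : IsMeshSize T h) {K : Finset R3}
    (hK : K ∈ cells T) (c : R3) :
    volume.real (convexHull ℝ (K : Set R3)) ≤
      8 / κ ^ 3 * volume.real (Metric.ball c (κ * h / 2)) := by
  have hpos := hh.pos
  obtain ⟨p, hp⟩ := Geometry.SimplicialComplex.nonempty_of_mem_faces hK.1
  have hsub : convexHull ℝ (K : Set R3) ⊆ Metric.closedBall p h := fun x hx =>
    (Metric.dist_le_diam_of_mem (isCompact_convexHull_finset K).isBounded hx
      (subset_convexHull ℝ _ hp)).trans (hh.2 ⟨K, hK, rfl⟩)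
  refine (measureReal_mono hsub measure_closedBall_lt_top.ne).trans ?_
  rw [Measure.addHaar_real_closedBall _ _ hpos.le, ← Measure.addHaar_real_closedBall_eq_addHaar_real_ball _ c (κ * h / 2),
    Measure.addHaar_real_closedBall _ _ (by positivity)]
  simp only [finrank_euclideanSpace, Fintype.card_fin]
  refine le_of_eq ?_
  field_simp
  ring

/-- The inverse estimate `‖∇u‖² ≤ C h⁻² ‖u‖²` with `C = 384 κ⁻⁵`, on a part of a regular mesh. -/
theorem gradNormSq_le_normSq {κ h : ℝ} (hκ : 0 < κ) (hh : IsMeshSize T h)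
    (hreg : IsRegularMesh κ h T) {T' : SimplicialComplex ℝ R3} (hsub : cells T' ⊆ cells T)
    (hT : IsTetrahedrization T' Ω) {u : R3 → F} (hu : IsP1 T' u) :
    gradNormSq Ω u ≤ 384 / κ ^ 5 * (h ^ 2)⁻¹ * normSq Ω u := by
  have hpos := hh.pos
  have key : ∀ i : Fin 3, ip Ω (pderiv i u) (pderiv i u) ≤
      128 / κ ^ 5 * (h ^ 2)⁻¹ * normSq Ω u := by
    intro i
    have hd := hu.cellwiseContinuous_pderiv i
    have huc := hu.cellwiseContinuous
    rw [normSq, ip, ip, hT.integral_eq_sum ((hd.inner hd).integrableOn hT),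
      hT.integral_eq_sum ((huc.inner huc).integrableOn hT), Finset.mul_sum]
    refine Finset.sum_le_sum fun K hK => ?_
    have hK' : K ∈ cells T' := by simpa using hK
    obtain ⟨A, hA⟩ := hu.affine K hK'
    obtain ⟨c, hc⟩ := hreg K (hsub hK')
    have hmeas := (isOpen_cellInterior K).measurableSet
    have e1 : ∫ x in cellInterior K, inner ℝ (pderiv i u x) (pderiv i u x) =
        volume.real (convexHull ℝ (K : Set R3)) * ‖A.linear (EuclideanSpace.single i 1)‖ ^ 2 := by
      rw [setIntegral_congr_fun (g := fun _ => ‖A.linear (EuclideanSpace.single i 1)‖ ^ 2) hmeas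
        fun x hx => ?_, setIntegral_const, smul_eq_mul,
        measureReal_congr (cellInterior_ae_eq K)]
      simp only [IsP1.pderiv_eqOn hA i hx, real_inner_self_eq_norm_sq]
    have e2 : ∫ x in cellInterior K, inner ℝ (u x) (u x) =
        ∫ x in convexHull ℝ (K : Set R3), ‖A x‖ ^ 2 := by
      rw [← setIntegral_congr_set (cellInterior_ae_eq K)]
      refine setIntegral_congr_fun hmeas fun x hx => ?_
      simp only [hA (cellInterior_subset K hx), real_inner_self_eq_norm_sq]
    rw [e1, e2]
    have h1 := sq_mul_norm_linear_sq_le A (isCompact_convexHull_finset K) (mul_pos hκ hpos) hc i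
    have h2 := volume_cell_le hκ hh (hsub hK') c
    set g := ‖A.linear (EuclideanSpace.single i 1)‖ ^ 2
    set b := volume.real (Metric.ball c (κ * h / 2))
    set I := ∫ x in convexHull ℝ (K : Set R3), ‖A x‖ ^ 2
    have hg : 0 ≤ g := sq_nonneg _
    -- Here `128 = 8 · 16`: the volume ratio times the constant for one ball, with `κ⁻²` from the
    -- radius `κ h`. Summing three partial derivatives gives 384.
    calc _ ≤ 8 / κ ^ 3 * b * g := mul_le_mul_of_nonneg_right h2 hg
      _ = 8 / κ ^ 3 * (κ ^ 2 * h ^ 2)⁻¹ * ((κ * h) ^ 2 * (b * g)) := by field_simp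
      _ ≤ 8 / κ ^ 3 * (κ ^ 2 * h ^ 2)⁻¹ * (16 * I) := by gcongr
      _ = _ := by field_simp; ring
  rw [gradNormSq, gradIp]
  calc _ ≤ ∑ _i : Fin 3, 128 / κ ^ 5 * (h ^ 2)⁻¹ * normSq Ω u :=
        Finset.sum_le_sum fun i _ => key i
    _ = _ := by simp; ring

end inverse

/-! ### Edge elements -/

section edge

theorem cross_combo_left (α β : ℝ) (b b' x : R3) :
    cross (α • b + β • b') x = α • cross b x + β • cross b' x := by
  simp only [cross, WithLp.ofLp_add, WithLp.ofLp_smul, map_add, map_smul, LinearMap.add_apply,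
    LinearMap.smul_apply, WithLp.toLp_add, WithLp.toLp_smul]

theorem inner_cross_right_self (u v : R3) : inner ℝ (cross u v) v = 0 := by
  simp only [cross, EuclideanSpace.inner_eq_star_dotProduct]
  simp [dot_cross_self]

/-- The affine map `x ↦ a + b × x`. -/
noncomputable def edgeAffine (a b : R3) : R3 →ᵃ[ℝ] R3 :=
  AffineMap.const ℝ R3 a +
    (((WithLp.linearEquiv 2 ℝ (Fin 3 → ℝ)).symm.toLinearMap.comp
      (crossProduct (WithLp.ofLp b))).comp
        (WithLp.linearEquiv 2 ℝ (Fin 3 → ℝ)).toLinearMap).toAffineMap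

theorem continuous_edge (a b : R3) : Continuous (fun x => a + cross b x) :=
  (edgeAffine a b).continuous_of_finiteDimensional

theorem edgeIntegral_combo (α β : ℝ) {f g : R3 → R3} (hf : Continuous f) (hg : Continuous g)
    (p q : R3) :
    edgeIntegral (fun x => α • f x + β • g x) p q =
      α * edgeIntegral f p q + β * edgeIntegral g p q := by
  simp only [edgeIntegral, inner_add_left, real_inner_smul_left]
  rw [intervalIntegral.integral_add, intervalIntegral.integral_const_mul,
    intervalIntegral.integral_const_mul]
  all_goals exact Continuous.intervalIntegrable (by fun_prop) _ _

/-- This makes `H^{(j+1/2)}` and `d_t H` admissible test functions. -/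
theorem IsEdgeElement.combo {ψ ζ : R3 → R3} (hψ : IsEdgeElement T ψ) (hζ : IsEdgeElement T ζ)
    (α β : ℝ) : IsEdgeElement T (fun x => α • ψ x + β • ζ x) := by
  obtain ⟨c, hc⟩ := hψ
  obtain ⟨d, hd⟩ := hζ
  refine ⟨fun p q => α * c p q + β * d p q, fun K hK => ?_⟩
  obtain ⟨a, b, hab, hc⟩ := hc K hK
  obtain ⟨a', b', hab', hd⟩ := hd K hK
  have hpt : ∀ x, α • a + β • a' + cross (α • b + β • b') x =
      α • (a + cross b x) + β • (a' + cross b' x) := fun x => by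
    rw [cross_combo_left]
    module
  refine ⟨α • a + β • a', α • b + β • b', fun x hx => ?_, fun p hp q hq => ?_⟩
  · simp only [hpt, hab x hx, hab' x hx]
  · simp only [hpt]
    rw [edgeIntegral_combo α β (continuous_edge a b) (continuous_edge a' b'), hc p hp q hq,
      hd p hp q hq]

theorem IsEdgeElement.exists_affine {ψ : R3 → R3} (hψ : IsEdgeElement T ψ) {K : Finset R3}
    (hK : K ∈ cells T) : ∃ A : R3 →ᵃ[ℝ] R3, Set.EqOn ψ A (cellInterior K) := by
  obtain ⟨c, hc⟩ := hψ
  obtain ⟨a, b, hab, -⟩ := hc K hK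
  exact ⟨edgeAffine a b, hab⟩

theorem IsEdgeElement.cellwiseContinuous {ψ : R3 → R3} (hψ : IsEdgeElement T ψ) :
    CellwiseContinuous T ψ := by
  intro K hK
  obtain ⟨A, hA⟩ := hψ.exists_affine hK
  exact ⟨A, A.continuous_of_finiteDimensional, hA⟩

theorem IsEdgeElement.pderiv_combo {ψ ζ : R3 → R3} (hψ : IsEdgeElement T ψ)
    (hζ : IsEdgeElement T ζ) (α β : ℝ) {K : Finset R3} (hK : K ∈ cells T) {x : R3}
    (hx : x ∈ cellInterior K) (i : Fin 3) :
    pderiv i (fun x => α • ψ x + β • ζ x) x = α • pderiv i ψ x + β • pderiv i ζ x := by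
  obtain ⟨A, hA⟩ := hψ.exists_affine hK
  obtain ⟨B, hB⟩ := hζ.exists_affine hK
  have hAB : Set.EqOn (fun x => α • ψ x + β • ζ x) (α • A + β • B : R3 →ᵃ[ℝ] R3)
      (cellInterior K) := fun x hx => by simp [hA hx, hB hx]
  have hU := isOpen_cellInterior K
  rw [pderiv_congr hU hAB hx, pderiv_congr hU hA hx, pderiv_congr hU hB hx, pderiv_affineMap,
    pderiv_affineMap, pderiv_affineMap]
  rfl

theorem IsEdgeElement.curl_combo {ψ ζ : R3 → R3} (hψ : IsEdgeElement T ψ)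
    (hζ : IsEdgeElement T ζ) (α β : ℝ) {K : Finset R3} (hK : K ∈ cells T) :
    Set.EqOn (curl (fun x => α • ψ x + β • ζ x)) (fun x => α • curl ψ x + β • curl ζ x)
      (cellInterior K) := by
  intro x hx
  have h := hψ.pderiv_combo hζ α β hK hx
  ext i
  fin_cases i <;> simp [curl, h] <;> ring

theorem IsEdgeElement.cellwiseContinuous_curl {ψ : R3 → R3} (hψ : IsEdgeElement T ψ) :
    CellwiseContinuous T (curl ψ) := by
  intro K hK
  obtain ⟨A, hA⟩ := hψ.exists_affine hK
  refine ⟨fun _ => curl A 0, continuous_const, fun x hx => ?_⟩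
  simp only [curl, pderiv_congr (isOpen_cellInterior K) hA hx, pderiv_affineMap]

theorem ip_combo_combo {F : Type*} [NormedAddCommGroup F] [InnerProductSpace ℝ F] {f g : R3 → F}
    (hT : IsTetrahedrization T Ω) (hf : CellwiseContinuous T f) (hg : CellwiseContinuous T g)
    (α β γ δ : ℝ) :
    ip Ω (fun x => α • f x + β • g x) (fun x => γ • f x + δ • g x) =
      α * γ * normSq Ω f + (α * δ + β * γ) * ip Ω f g + β * δ * normSq Ω g := by
  rw [ip_add_left hT (hf.smul α) (hg.smul β) ((hf.smul γ).add (hg.smul δ)),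
    ip_add_right hT (hf.smul γ) (hg.smul δ) (hf.smul α),
    ip_add_right hT (hf.smul γ) (hg.smul δ) (hg.smul β)]
  simp only [ip_smul_left, ip_smul_right, normSq]
  rw [ip_comm Ω g f]
  ring

theorem half_eq_combo (H : ℕ → R3 → R3) (j : ℕ) :
    half H j = fun x => (2 : ℝ)⁻¹ • H (j + 1) x + (2 : ℝ)⁻¹ • H j x := by
  ext1 x
  simp only [half, smul_add]

theorem dt_eq_combo (k : ℝ) (H : ℕ → R3 → R3) (j : ℕ) :
    dt k H (j + 1) = fun x => k⁻¹ • H (j + 1) x + (-k⁻¹) • H j x := by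
  ext1 x
  simp only [dt, Nat.add_sub_cancel]
  module

theorem ip_dt_half {H : ℕ → R3 → R3} {j : ℕ} (hT : IsTetrahedrization T Ω)
    (h1 : IsEdgeElement T (H (j + 1))) (h0 : IsEdgeElement T (H j)) (k : ℝ) :
    ip Ω (dt k H (j + 1)) (half H j) =
      k⁻¹ * 2⁻¹ * (normSq Ω (H (j + 1)) - normSq Ω (H j)) := by
  rw [dt_eq_combo, half_eq_combo, ip_combo_combo hT h1.cellwiseContinuous h0.cellwiseContinuous]
  ring

theorem ip_curl_half_curl_dt {H : ℕ → R3 → R3} {j : ℕ} (hT : IsTetrahedrization T Ω)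
    (h1 : IsEdgeElement T (H (j + 1))) (h0 : IsEdgeElement T (H j)) (k : ℝ) :
    ip Ω (curl (half H j)) (curl (dt k H (j + 1))) =
      k⁻¹ * 2⁻¹ * (normSq Ω (curl (H (j + 1))) - normSq Ω (curl (H j))) := by
  rw [dt_eq_combo, half_eq_combo, ip_congr hT (fun K hK => h1.curl_combo h0 _ _ hK)
    (fun K hK => h1.curl_combo h0 _ _ hK),
    ip_combo_combo hT h1.cellwiseContinuous_curl h0.cellwiseContinuous_curl]
  ring

theorem ip_indicator {D Dt : Set R3} (hD : MeasurableSet D) (hsub : D ⊆ Dt) (u w : R3 → R3) :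
    ip Dt (D.indicator u) w = ip D u w := by
  have : ∀ x, inner ℝ (D.indicator u x) (w x) = D.indicator (fun x => inner ℝ (u x) (w x)) x := by
    intro x
    by_cases hx : x ∈ D <;> simp [hx]
  simp only [ip, this]
  rw [setIntegral_indicator hD, Set.inter_eq_self_of_subset_right hsub]

theorem normSq_mono {D Dt : Set R3} (hT : IsTetrahedrization T Dt) (hsub : D ⊆ Dt)
    {u : R3 → R3} (hu : CellwiseContinuous T u) : normSq D u ≤ normSq Dt u :=
  setIntegral_mono_set ((hu.inner hu).integrableOn hT)
    (Filter.Eventually.of_forall fun _ => real_inner_self_nonneg) hsub.eventuallyLE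

end edge

/-! ### The scheme -/

/-- Mesh vertices may lie on the boundary of `D`, so the a.e. constraint is first upgraded to all of
`D` by continuity, then passed to the closure. -/
theorem norm_eq_one_of_ae {D : Set R3} (hD : IsOpen D) {f : R3 → R3}
    (hf : ContinuousOn f (closure D)) (h : ∀ᵐ x ∂volume.restrict D, ‖f x‖ = 1) {x : R3}
    (hx : x ∈ closure D) : ‖f x‖ = 1 := by
  have hD1 : Set.EqOn (fun x => ‖f x‖) (fun _ => 1) D :=
    Measure.eqOn_open_of_ae_eq h hD (hf.mono subset_closure).norm continuousOn_const
  exact hD1.of_subset_closure hf.norm continuousOn_const subset_closure subset_rfl hx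

theorem mem_closure_of_mem_vertices_restrict {D : Set R3} {p : R3}
    (hp : p ∈ (restrict T D).vertices) : p ∈ closure D :=
  hp.2 (subset_convexHull ℝ _ (by simp))

/-- Pythagoras. It keeps the normalization well defined and places it where radial projection is
nonexpansive. -/
theorem one_le_norm_add_smul {x y : R3} (hx : ‖x‖ = 1) (hxy : inner ℝ y x = 0) (k : ℝ) :
    1 ≤ ‖x + k • y‖ := by
  have h : 1 ≤ ‖x + k • y‖ ^ 2 := by
    rw [norm_add_sq_real, real_inner_smul_right, real_inner_comm, hxy, hx]
    nlinarith [sq_nonneg ‖k • y‖]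
  nlinarith [norm_nonneg (x + k • y)]

/-- The algebra of one step. Primes mark the new time level; `gm`, `Hn`, `Cn` are the squared norms
of `∇m`, `H`, `∇ × H`; `gv`, `nv`, `nd`, `nc` those of `∇v`, `v`, `d_t H`, `∇ × H^{(j+1/2)}`, with
`ndD` that of `d_t H` over `D` alone. Further, `gmv = ⟨∇m, ∇v⟩`, `p = ⟨v, H^{(j+1/2)}⟩` and `q = ⟨v,
d_t H⟩`. The sum of `h1`, `e2`, `e3` eliminates `p`; `e5` bounds `q`. -/
theorem energy_step_of_identities {lam₂ σ μ₀ μ θ k gm gm' gmv gv nv nd nc ndD p q Hn Hn' Cn Cn' : ℝ}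
    (hlam : 0 < lam₂) (hμ : 0 < μ) (hμ₀ : 0 < μ₀) (hk : 0 < k)
    (h1 : gm' ≤ gm + 2 * k * gmv + k ^ 2 * gv)
    (h2 : lam₂ * nv = -μ * (gmv + k * θ * gv) + μ * p)
    (h3 : μ₀ * (k⁻¹ * 2⁻¹ * (Hn' - Hn)) + σ * nc = -μ₀ * p)
    (h4 : μ₀ * nd + σ * (k⁻¹ * 2⁻¹ * (Cn' - Cn)) = -μ₀ * q)
    (h5 : -(2 * q) ≤ nv + ndD) (h6 : ndD ≤ nd) :
    gm' + Hn' + lam₂ * μ⁻¹ * μ₀⁻¹ * σ * Cn' + lam₂ * μ⁻¹ * (k * nv) + lam₂ * μ⁻¹ * (k * nd)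
      + 2 * μ₀⁻¹ * σ * (k * nc) ≤
    gm + Hn + lam₂ * μ⁻¹ * μ₀⁻¹ * σ * Cn + (1 - 2 * θ) * k * (k * gv) := by
  have e2 : gmv = -(lam₂ * μ⁻¹ * nv) - k * θ * gv + p := by
    field_simp
    linarith
  have e3 : Hn' - Hn = -(2 * μ₀⁻¹ * σ * (k * nc)) - 2 * k * p := by
    field_simp at h3 ⊢
    linarith
  have e4 : μ₀⁻¹ * σ * (Cn' - Cn) = -(2 * k * q) - 2 * k * nd := by
    field_simp at h4 ⊢
    linarith
  have e5 : lam₂ * μ⁻¹ * k * -(2 * q) ≤ lam₂ * μ⁻¹ * k * (nv + nd) :=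
    mul_le_mul_of_nonneg_left (by linarith) (by positivity)
  have e6 : lam₂ * μ⁻¹ * (μ₀⁻¹ * σ * (Cn' - Cn)) = lam₂ * μ⁻¹ * (-(2 * k * q) - 2 * k * nd) := by
    rw [e4]
  subst e2
  linarith

theorem energy_step {Dt D : Set R3} {m v H : ℕ → R3 → R3} {m₀ H₀ : R3 → R3}
    {lam₁ lam₂ σ μ₀ μ θ k : ℝ} {J j : ℕ}
    (hsub : D ⊆ Dt) (hTt : IsTetrahedrization T Dt) (hT : IsTetrahedrization (restrict T D) D)
    (hst : HasNonposStiffness (restrict T D) D)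
    (hlam : 0 < lam₂) (hμ : 0 < μ) (hμ₀ : 0 < μ₀) (hk : 0 < k)
    (hs : IsSchemeOutput Dt D T lam₁ lam₂ μ σ μ₀ θ k J m₀ H₀ m v H) (hj : j < J)
    (hm : IsP1 (restrict T D) (m j)) (hH : IsEdgeElement T (H j))
    (hnorm : ∀ p ∈ (restrict T D).vertices, ‖m j p‖ = 1) :
    energy Dt D lam₂ μ σ μ₀ (m (j + 1)) (H (j + 1)) + lam₂ * μ⁻¹ * (k * normSq D (v (j + 1)))
      + lam₂ * μ⁻¹ * (k * normSq Dt (dt k H (j + 1)))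
      + 2 * μ₀⁻¹ * σ * (k * normSq Dt (curl (half H j))) ≤
    energy Dt D lam₂ μ σ μ₀ (m j) (H j)
      + (1 - 2 * θ) * k * (k * gradNormSq D (v (j + 1))) := by
  have hv := hs.mem_v j hj
  have hH' := hs.mem_H j hj
  have hup := hs.update j hj
  have hhalf : IsEdgeElement T (half H j) := half_eq_combo H j ▸ hH'.combo hH _ _
  have hdt : IsEdgeElement T (dt k H (j + 1)) := dt_eq_combo k H j ▸ hH'.combo hH _ _
  have hDm := hT.isOpen.measurableSet
  have h1 : gradNormSq D (m (j + 1)) ≤ gradNormSq D (m j) + 2 * k * gradIp D (m j) (v (j + 1))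
      + k ^ 2 * gradNormSq D (v (j + 1)) := by
    rw [← gradNormSq_add_smul hT hm hv.isP1]
    refine gradNormSq_le_of_nodal hT hst (hm.add_smul hv.isP1 k) hup.isP1 fun p hp q hq => ?_
    rw [hup.nodal p hp, hup.nodal q hq]
    exact norm_normalize_sub_le (one_le_norm_add_smul (hnorm p hp) (hv.orth p hp) k)
      (one_le_norm_add_smul (hnorm q hq) (hv.orth q hq) k)
  have h2 := hs.llg j hj _ hv
  have hcross : ip D (fun x => cross (m j x) (v (j + 1) x)) (v (j + 1)) = 0 := by
    simp [ip, inner_cross_right_self]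
  rw [hcross, mul_zero, sub_zero, gradIp_add_smul_left hT hm hv.isP1 hv.isP1, ip_comm D (half H j)]
    at h2
  have h3 := hs.maxwell j hj _ hhalf
  rw [ip_dt_half hTt hH' hH, ip_indicator hDm hsub] at h3
  have h4 := hs.maxwell j hj _ hdt
  rw [ip_curl_half_curl_dt hTt hH' hH, ip_indicator hDm hsub] at h4
  have h5 := neg_two_mul_ip_le hT hv.isP1.cellwiseContinuous (hdt.cellwiseContinuous.restrict D)
  exact energy_step_of_identities hlam hμ hμ₀ hk h1 h2 h3 h4 h5
    (normSq_mono hTt hsub hdt.cellwiseContinuous)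

theorem IsSchemeOutput.invariants {Dt D : Set R3} {m v H : ℕ → R3 → R3} {m₀ H₀ : R3 → R3}
    {lam₁ lam₂ σ μ₀ μ θ k : ℝ} {J : ℕ} (hT : IsTetrahedrization (MLLG.restrict T D) D)
    (hm₀ : ContinuousOn m₀ (closure D)) (hm₀n : ∀ᵐ x ∂volume.restrict D, ‖m₀ x‖ = 1)
    (hs : IsSchemeOutput Dt D T lam₁ lam₂ μ σ μ₀ θ k J m₀ H₀ m v H) :
    ∀ j ≤ J, IsP1 (MLLG.restrict T D) (m j) ∧ IsEdgeElement T (H j) ∧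
      ∀ p ∈ (MLLG.restrict T D).vertices, ‖m j p‖ = 1 := by
  intro j
  induction j with
  | zero =>
    refine fun _ => ⟨hs.init_m.isP1, ⟨_, hs.init_H⟩, fun p hp => ?_⟩
    rw [hs.init_m.nodal p hp]
    exact norm_eq_one_of_ae hT.isOpen hm₀ hm₀n (mem_closure_of_mem_vertices_restrict hp)
  | succ j ih =>
    intro hj
    obtain ⟨-, -, hn⟩ := ih (by omega)
    refine ⟨(hs.update j hj).isP1, hs.mem_H j hj, fun p hp => ?_⟩
    have h1 := one_le_norm_add_smul (hn p hp) ((hs.mem_v j hj).orth p hp) k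
    rw [(hs.update j hj).nodal p hp, norm_smul, norm_inv, norm_norm,
      inv_mul_cancel₀ (by linarith : (0 : ℝ) < _).ne']

end MLLG

theorem lemma4p1 (κ : ℝ) (hκ : 0 < κ) :
    ∃ C₁ : ℝ, 0 < C₁ ∧
      ∀ (Dt D : Set MLLG.R3) (T : Geometry.SimplicialComplex ℝ MLLG.R3) (h : ℝ),
        D ⊆ Dt →
        MLLG.IsTetrahedrization T Dt →
        MLLG.IsTetrahedrization (MLLG.restrict T D) D →
        MLLG.IsMeshSize T h →
        MLLG.IsRegularMesh κ h T →
        MLLG.HasNonposStiffness (MLLG.restrict T D) D →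
      ∀ (lam₁ lam₂ σ μ₀ μ : ℝ), lam₁ ≠ 0 → 0 < lam₂ → 0 ≤ σ → 0 < μ₀ →
        μ = lam₁ ^ 2 + lam₂ ^ 2 →
      ∀ (θ : ℝ), 0 ≤ θ → θ ≤ 1 →
      ∀ (tEnd k : ℝ) (J : ℕ), 0 < tEnd → 0 < J → k = tEnd / J →
      ∀ (m₀ H₀ : MLLG.R3 → MLLG.R3),
        ContinuousOn m₀ (closure D) →
        (∀ᵐ x ∂(MeasureTheory.volume.restrict D), ‖m₀ x‖ = 1) →
        MLLG.HasEdgeTraces T H₀ →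
      ∀ (m v H : ℕ → MLLG.R3 → MLLG.R3),
        MLLG.IsSchemeOutput Dt D T lam₁ lam₂ μ σ μ₀ θ k J m₀ H₀ m v H →
      ∀ j ≤ J,
        MLLG.energy Dt D lam₂ μ σ μ₀ (m j) (H j)
          + (if 1 / 2 ≤ θ then lam₂ * μ⁻¹
              else lam₂ * μ⁻¹ - (1 - 2 * θ) * C₁ * k * (h ^ 2)⁻¹)
            * ∑ i ∈ Finset.range j, k * MLLG.normSq D (v (i + 1))
          + lam₂ * μ⁻¹ * ∑ i ∈ Finset.range j, k * MLLG.normSq Dt (MLLG.dt k H (i + 1))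
          + 2 * μ₀⁻¹ * σ
            * ∑ i ∈ Finset.range j, k * MLLG.normSq Dt (MLLG.curl (MLLG.half H i))
        ≤ MLLG.energy Dt D lam₂ μ σ μ₀ (m 0) (H 0) := by
  refine ⟨384 / κ ^ 5, by positivity, ?_⟩
  intro Dt D T h hsub hTt hT hh hreg hst lam₁ lam₂ σ μ₀ μ hlam₁ hlam hσ hμ₀ hμ θ _ _ tEnd k J
    htEnd hJ hk m₀ H₀ hm₀ hm₀n _ m v H hs j hj
  have hJ' : (0 : ℝ) < J := by exact_mod_cast hJ
  have hk0 : 0 < k := hk ▸ div_pos htEnd hJ'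
  have hμ0 : 0 < μ := by rw [hμ]; positivity
  have hinv := hs.invariants hT hm₀ hm₀n
  induction j with
  | zero => simp
  | succ j ih =>
    have ih := ih (by omega)
    obtain ⟨hm, hH, hn⟩ := hinv j (by omega)
    have hstep := MLLG.energy_step hsub hTt hT hst hlam hμ0 hμ₀ hk0 hs hj hm hH hn
    simp only [Finset.sum_range_succ, mul_add]
    split_ifs at ih ⊢ with hθ
    · have hg := mul_nonneg hk0.le (mul_nonneg hk0.le
        (MLLG.gradNormSq_nonneg D (v (j + 1))))
      have : (1 - 2 * θ) * k * (k * MLLG.gradNormSq D (v (j + 1))) ≤ 0 := by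
        rw [mul_assoc]
        exact mul_nonpos_of_nonpos_of_nonneg (by linarith) hg
      linarith
    -- For `θ < 1/2` the leftover gradient term has the wrong sign, and the inverse estimate moves
    -- it into the coefficient of `‖v‖²`.
    · have hie := MLLG.gradNormSq_le_normSq hκ hh hreg (MLLG.cells_restrict_subset T D) hT
        (hs.mem_v j hj).isP1
      have hc : 0 ≤ (1 - 2 * θ) * k := mul_nonneg (by linarith) hk0.le
      have := mul_le_mul_of_nonneg_left (mul_le_mul_of_nonneg_left hie hk0.le) hc
      linarith
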